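/- On $\mathbb{R}^6=e(3)$ with coordinates $(M,\Gamma)=(M_1,M_2,M_3,\Gamma_1,\Gamma_2,\Gamma_3)$ consider the Lie--Poisson structure $\{M_i,M_j\}=-\epsilon_{ijk}M_k$, $\{M_i,\Gamma_j\}=-\epsilon_{ijk}\Gamma_k$, $\{\Gamma_i,\Gamma_j\}=0$. Let $I_2,X_0,Z_0$ be real numbers with $I_2\neq 0$ and $X_0\ne 0$ or $Z_0\neq 0$, let $a=a(M,\Gamma)$ be a polynomial, and consider the system $$ \begin{aligned} \dot M_1&=Z_0\Gamma_2+aZ_0M_2, & \dot\Gamma_1&=\tfrac{1}{I_2}(\Gamma_2M_3-\Gamma_3M_2)+aZ_0\Gamma_2,\\ \dot M_2&=X_0\Gamma_3-Z_0\Gamma_1+a(X_0M_3-Z_0M_1), & \dot\Gamma_2&=\tfrac{1}{I_2}(\Gamma_3M_1-\Gamma_1M_3)+a(X_0\Gamma_3-Z_0\Gamma_1),\\ \dot M_3&=-X_0\Gamma_2-aX_0M_2, & \dot\Gamma_3&=\tfrac{1}{I_2}(\Gamma_1M_2-\Gamma_2M_1)-aX_0\Gamma_2 . \end{aligned}\tag{$*$}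 $$ Put $F_1=M_1\Gamma_1+M_2\Gamma_2+M_3\Gamma_3$, $F_2=\Gamma_1^2+\Gamma_2^2+\Gamma_3^2$, $H_1=\frac{M_1^2+M_2^2+M_3^2}{2I_2}+X_0\Gamma_1+Z_0\Gamma_3$, $H_2=X_0M_1+Z_0M_3$. **Theorem.** (1) In each of the cases (i) $a=M_1\Gamma_1+M_2\Gamma_2+M_3\Gamma_3$, (ii) $a=\Gamma_1^2+\Gamma_2^2+\Gamma_3^2$, (iii) $a=X_0M_1+Z_0M_3$, system $(*)$ is completely integrable in the Liouville sense: it is Hamiltonian, $\dot x=\{x,H\}$, with a smooth Hamiltonian $H$, and there is a smooth function $K$ such that $F_1,F_2,H,K$ are pairwise in involution and, on every four-dimensional symplectic leaf $\{F_1=c_1,F_2=c_2\}$, $c_1\in\mathbb{R}$, $c_2>0$, the differentials of $F_1,F_2,H,K$ are linearly independent on a dense subset of the leaf (that is, $H$ and $K$ restricted to the leaf are functionally independent). (2) In each of the cases (iv) $a=X_0\Gamma_1+Z_0\Gamma_3$, (v) $a=M_1^2+M_2^2+M_3^2$, system $(*)$ is integrable in quadratures by means of an invariant measure and four first integrals: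 it preserves the standard measure (its right-hand side has zero divergence); $F_1,F_2,H_1,H_2$ are first integrals, with linearly independent differentials on a dense subset of $\mathbb{R}^6$; and the system can be solved by quadratures, i.e. for every solution defined on an open set $J\subseteq\mathbb{R}$ of times, there is a dense set of times in $J$ near each of which all coordinates of the solution are obtained from constants and the function $t$ by finitely many algebraic operations (arithmetic operations and extraction of continuous simple roots of polynomial equations with already known coefficients), compositions, inversions of functions, and quadratures (antiderivatives of already known functions). -/

import Mathlib

open scoped ContDiff

namespace RigidE3

/-- The six-dimensional phase space `e(3)` with linear coordinates `M₁, M₂, M₃` (left summand)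
and `Γ₁, Γ₂, Γ₃` (right summand); the indices `1, 2, 3` are `0, 1, 2 : Fin 3`. -/
abbrev Phase : Type := Fin 3 ⊕ Fin 3 → ℝ

/-- The coordinate vector `M`. -/
def mom (x : Phase) (i : Fin 3) : ℝ := x (Sum.inl i)

/-- The coordinate vector `Γ`. -/
def gam (x : Phase) (i : Fin 3) : ℝ := x (Sum.inr i)

/-- The Levi-Civita symbol: `ε₁₂₃ = 1`, totally antisymmetric. -/
noncomputable def eps (i j k : Fin 3) : ℝ :=
  (((j : ℕ) : ℝ) - ((i : ℕ) : ℝ)) * (((k : ℕ) : ℝ) - ((j : ℕ) : ℝ)) *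
    (((k : ℕ) : ℝ) - ((i : ℕ) : ℝ)) / 2

/-- The matrix `P^{pq} = {x^p, x^q}` of the standard Lie-Poisson structure of `e(3)`:
`{M_i, M_j} = -ε_{ijk} M_k`, `{M_i, Γ_j} = -ε_{ijk} Γ_k`, `{Γ_i, Γ_j} = 0`. -/
noncomputable def poissonMatrix (x : Phase) : Matrix (Fin 3 ⊕ Fin 3) (Fin 3 ⊕ Fin 3) ℝ
  | Sum.inl i, Sum.inl j => -∑ k, eps i j k * mom x k
  | Sum.inl i, Sum.inr j => -∑ k, eps i j k * gam x k
  | Sum.inr i, Sum.inl j => ∑ k, eps j i k * gam x k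
  | Sum.inr _, Sum.inr _ => 0

/-- Partial derivative with respect to the coordinate `x^p`. -/
noncomputable def partialD (p : Fin 3 ⊕ Fin 3) (f : Phase → ℝ) (x : Phase) : ℝ :=
  fderiv ℝ f x (Pi.single p 1)

/-- The Poisson bracket `{f, g} = ∑ P^{pq} ∂_p f ∂_q g`. -/
noncomputable def bracket (f g : Phase → ℝ) (x : Phase) : ℝ :=
  ∑ p, ∑ q, poissonMatrix x p q * partialD p f x * partialD q g x

/-- `F₁ = M₁Γ₁ + M₂Γ₂ + M₃Γ₃`. -/
def F₁ (x : Phase) : ℝ := mom x 0 * gam x 0 + mom x 1 * gam x 1 + mom x 2 * gam x 2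

/-- `F₂ = Γ₁² + Γ₂² + Γ₃²`. -/
def F₂ (x : Phase) : ℝ := gam x 0 ^ 2 + gam x 1 ^ 2 + gam x 2 ^ 2

/-- `H₁ = (M₁² + M₂² + M₃²) / (2 I₂) + (X₀Γ₁ + Z₀Γ₃)`. -/
noncomputable def H₁ (I₂ X₀ Z₀ : ℝ) (x : Phase) : ℝ :=
  (mom x 0 ^ 2 + mom x 1 ^ 2 + mom x 2 ^ 2) / (2 * I₂) + (X₀ * gam x 0 + Z₀ * gam x 2)

/-- `H₂ = X₀M₁ + Z₀M₃`. -/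
def H₂ (X₀ Z₀ : ℝ) (x : Phase) : ℝ := X₀ * mom x 0 + Z₀ * mom x 2

/-- The vector field on the right-hand side of the system, for an arbitrary function `a`. -/
noncomputable def system (I₂ X₀ Z₀ : ℝ) (a : Phase → ℝ) (x : Phase) : Phase :=
  Sum.elim
    ![Z₀ * gam x 1 + a x * Z₀ * mom x 1,
      X₀ * gam x 2 - Z₀ * gam x 0 + a x * (X₀ * mom x 2 - Z₀ * mom x 0),
      -X₀ * gam x 1 - a x * X₀ * mom x 1]
    ![(gam x 1 * mom x 2 - gam x 2 * mom x 1) / I₂ + a x * Z₀ * gam x 1,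
      (gam x 2 * mom x 0 - gam x 0 * mom x 2) / I₂ + a x * (X₀ * gam x 2 - Z₀ * gam x 0),
      (gam x 0 * mom x 1 - gam x 1 * mom x 0) / I₂ - a x * X₀ * gam x 1]

/-- Case (i). -/
def aI (x : Phase) : ℝ := mom x 0 * gam x 0 + mom x 1 * gam x 1 + mom x 2 * gam x 2

/-- Case (ii). -/
def aII (x : Phase) : ℝ := gam x 0 ^ 2 + gam x 1 ^ 2 + gam x 2 ^ 2

/-- Case (iii). -/
def aIII (X₀ Z₀ : ℝ) (x : Phase) : ℝ := X₀ * mom x 0 + Z₀ * mom x 2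

/-- Case (iv). -/
def aIV (X₀ Z₀ : ℝ) (x : Phase) : ℝ := X₀ * gam x 0 + Z₀ * gam x 2

/-- Case (v). -/
def aV (x : Phase) : ℝ := mom x 0 ^ 2 + mom x 1 ^ 2 + mom x 2 ^ 2

/-- The differentials of the four functions are linearly independent at `x`. -/
def IndependentAt (f : Fin 4 → Phase → ℝ) (x : Phase) : Prop :=
  LinearIndependent ℝ fun i => fderiv ℝ (f i) x

/-- The symplectic leaf `F₁ = c₁, F₂ = c₂`; it is four-dimensional for `c₂ > 0`. -/
def leaf (c₁ c₂ : ℝ) : Set Phase := {x | F₁ x = c₁ ∧ F₂ x = c₂}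

/-- `X` is the Hamiltonian vector field of `H`: `X^p = {x^p, H}`. -/
def IsHamiltonianFor (X : Phase → Phase) (H : Phase → ℝ) : Prop :=
  ∀ x p, X x p = bracket (fun y => y p) H x

/-- Complete integrability in the Liouville sense of a vector field on `e(3)`: it is Hamiltonian
with a smooth Hamiltonian `H`, and there is a smooth `K` such that the two Casimir functions
`F₁, F₂` together with `H, K` are pairwise in involution and, on every four-dimensional
symplectic leaf, have independent differentials on a dense subset of the leaf.
(The last condition says that the restrictions of `H` and `K` to the leaf are functionally
independent there.) -/
def IsLiouvilleIntegrable (X : Phase → Phase) : Prop :=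
  ∃ H K : Phase → ℝ, ContDiff ℝ ∞ H ∧ ContDiff ℝ ∞ K ∧
    IsHamiltonianFor X H ∧
    (∀ i j x, bracket (![F₁, F₂, H, K] i) (![F₁, F₂, H, K] j) x = 0) ∧
    ∀ c₁ c₂ : ℝ, 0 < c₂ →
      leaf c₁ c₂ ⊆ closure {x | x ∈ leaf c₁ c₂ ∧ IndependentAt ![F₁, F₂, H, K] x}

/-- `f` is a first integral of `ẋ = X(x)`: `X(f) = ∑ ∂_p f X^p = 0`. -/
def IsFirstIntegral (X : Phase → Phase) (f : Phase → ℝ) : Prop :=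
  ContDiff ℝ ∞ f ∧ ∀ x, fderiv ℝ f x (X x) = 0

/-- The smooth vector field `X` preserves the standard measure: its divergence vanishes. -/
def PreservesStandardMeasure (X : Phase → Phase) : Prop :=
  ContDiff ℝ ∞ X ∧ ∀ x, ∑ p, partialD p (fun y => X y p) x = 0

/-- `ByQuadratures U f`: on the set `U`, the function `f` of one real variable is obtained from
constants and the identity by finitely many algebraic operations (arithmetic, extraction of a
continuous simple root of a polynomial equation with known coefficients), compositions,
inversions of functions, and quadratures (antiderivatives of known functions). -/
inductive ByQuadratures : Set ℝ → (ℝ → ℝ) → Prop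
  | const (U : Set ℝ) (c : ℝ) : ByQuadratures U fun _ => c
  | ident (U : Set ℝ) : ByQuadratures U fun t => t
  | add {U : Set ℝ} {f g : ℝ → ℝ} (hf : ByQuadratures U f) (hg : ByQuadratures U g) :
      ByQuadratures U fun t => f t + g t
  | mul {U : Set ℝ} {f g : ℝ → ℝ} (hf : ByQuadratures U f) (hg : ByQuadratures U g) :
      ByQuadratures U fun t => f t * g t
  | algebraic {U : Set ℝ} {f : ℝ → ℝ} (n : ℕ) (c : Fin (n + 1) → ℝ → ℝ)
      (hc : ∀ k, ByQuadratures U (c k)) (hf : ContinuousOn f U)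
      (hroot : ∀ t ∈ U, ∑ k : Fin (n + 1), c k t * f t ^ (k : ℕ) = 0)
      (hsimple : ∀ t ∈ U, ∑ k : Fin (n + 1), ((k : ℕ) : ℝ) * c k t * f t ^ ((k : ℕ) - 1) ≠ 0) :
      ByQuadratures U f
  | comp {U V : Set ℝ} {f g : ℝ → ℝ} (hV : IsOpen V) (hg : ByQuadratures V g)
      (hf : ByQuadratures U f) (hmaps : Set.MapsTo f U V) : ByQuadratures U fun t => g (f t)
  | inverse {U V : Set ℝ} {f g : ℝ → ℝ} (hV : IsOpen V) (hg : ByQuadratures V g)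
      (hg' : ∀ s ∈ V, deriv g s ≠ 0) (hf : ContinuousOn f U) (hmaps : Set.MapsTo f U V)
      (hinv : ∀ t ∈ U, g (f t) = t) : ByQuadratures U f
  | quadrature {U : Set ℝ} {f F : ℝ → ℝ} (hf : ByQuadratures U f)
      (hF : ∀ t ∈ U, HasDerivAt F (f t) t) : ByQuadratures U F

/-- The system `ẋ = X(x)` can be solved by quadratures: for each of its solutions `γ`, defined on
an open set `J` of times, all the coordinates of `γ` are obtained by quadratures on a neighbourhood
of each time of a dense subset of `J`.  (Exceptional times such as turning points, where a quadrature
cannot be inverted, have to be left out.) -/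
def SolvableByQuadratures (X : Phase → Phase) : Prop :=
  ∀ (J : Set ℝ) (γ : ℝ → Phase), IsOpen J → (∀ t ∈ J, HasDerivAt γ (X (γ t)) t) →
    J ⊆ closure {t | ∃ r > 0, Set.Ioo (t - r) (t + r) ⊆ J ∧
      ∀ p, ByQuadratures (Set.Ioo (t - r) (t + r)) fun s => γ s p}

/-- Integrability in quadratures by means of the four functions `f`: the standard measure is
invariant, the four functions are first integrals, functionally independent on a dense set of
points, and the system can be solved by quadratures. -/
def IsIntegrableInQuadraturesWith (X : Phase → Phase) (f : Fin 4 → Phase → ℝ) : Prop :=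
  PreservesStandardMeasure X ∧ (∀ i, IsFirstIntegral X (f i)) ∧
    Dense {x | IndependentAt f x} ∧ SolvableByQuadratures X

end RigidE3

namespace RigidE3

open Filter Topology

/-! Write `n = (X₀, 0, Z₀)`. The system is `{x, H₁} + a {x, H₂}`, and `{x, H₂}` generates
simultaneous rotations of `M` and `Γ` about `n`. Since `H₁` is invariant under them, `F₁, F₂, H₁,
H₂` are in involution and are first integrals for every `a`.

If `dH = dH₁ + a dH₂` modulo the differentials of the Casimirs, the system is Hamiltonian with
Hamiltonian `H`. This happens for `H₁ + F₁H₂`, `H₁ + F₂H₂` and `H₁ + H₂²/2`, which are the three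
Liouville cases, with `K = H₂`. Independence holds wherever `n, Γ, M` are linearly independent
(`independentAt_of_tripleDet_ne_zero`), and `leaf_subset_closure_tripleDet` makes such points dense
in each leaf.

In the other two cases `a` is invariant under the rotations, and the divergence is the derivative of
`a` along them, hence zero. For the quadratures, put `u = n · Γ`. The derivative of `u` does not
involve `a`, and the integrals give `u̇² = R(u)` with `R` a cubic, so `u` inverts an integral
(`of_autonomous`). On a level of `H₁`, `a` is affine in `u`; hence the angular velocity of the part
of `M` orthogonal to `n` is a known function of `u`, and one more quadrature gives its polar angle
(`polar`). The rest is linear algebra. -/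

/-! ### Differentials of the integrals -/

lemma hasFDerivAt_coord (p : Fin 3 ⊕ Fin 3) (x : Phase) :
    HasFDerivAt (fun y : Phase => y p) (ContinuousLinearMap.proj (R := ℝ) p) x :=
  (ContinuousLinearMap.proj (R := ℝ) (φ := fun _ : Fin 3 ⊕ Fin 3 => ℝ) p).hasFDerivAt

lemma hasFDerivAt_mom (i : Fin 3) (x : Phase) :
    HasFDerivAt (fun y : Phase => mom y i) (ContinuousLinearMap.proj (R := ℝ) (Sum.inl i)) x :=
  hasFDerivAt_coord _ x

lemma hasFDerivAt_gam (i : Fin 3) (x : Phase) :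
    HasFDerivAt (fun y : Phase => gam y i) (ContinuousLinearMap.proj (R := ℝ) (Sum.inr i)) x :=
  hasFDerivAt_coord _ x

@[fun_prop] lemma contDiff_mom (i : Fin 3) : ContDiff ℝ ∞ fun y : Phase => mom y i :=
  contDiff_apply ℝ ℝ _

@[fun_prop] lemma contDiff_gam (i : Fin 3) : ContDiff ℝ ∞ fun y : Phase => gam y i :=
  contDiff_apply ℝ ℝ _

@[fun_prop] lemma contDiff_F₁ : ContDiff ℝ ∞ F₁ := by unfold F₁; fun_prop

@[fun_prop] lemma contDiff_F₂ : ContDiff ℝ ∞ F₂ := by unfold F₂; fun_prop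

@[fun_prop] lemma contDiff_H₁ (I X Z : ℝ) : ContDiff ℝ ∞ (H₁ I X Z) := by unfold H₁; fun_prop

@[fun_prop] lemma contDiff_H₂ (X Z : ℝ) : ContDiff ℝ ∞ (H₂ X Z) := by unfold H₂; fun_prop

lemma differentiableAt_of_smooth {f : Phase → ℝ} (hf : ContDiff ℝ ∞ f) (x : Phase) :
    DifferentiableAt ℝ f x := (hf.differentiable (by simp)) x

lemma fderiv_F₁ (x v : Phase) : fderiv ℝ F₁ x v =
    mom x 0 * gam v 0 + mom x 1 * gam v 1 + mom x 2 * gam v 2 +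
      (gam x 0 * mom v 0 + gam x 1 * mom v 1 + gam x 2 * mom v 2) := by
  have h := (((hasFDerivAt_mom 0 x).mul (hasFDerivAt_gam 0 x)).add
    ((hasFDerivAt_mom 1 x).mul (hasFDerivAt_gam 1 x))).add
    ((hasFDerivAt_mom 2 x).mul (hasFDerivAt_gam 2 x))
  have := h.fderiv
  change fderiv ℝ F₁ x = _ at this
  rw [this]
  simp [mom, gam]
  ring

lemma fderiv_F₂ (x v : Phase) : fderiv ℝ F₂ x v =
    2 * (gam x 0 * gam v 0 + gam x 1 * gam v 1 + gam x 2 * gam v 2) := by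
  have h := (((hasFDerivAt_gam 0 x).pow 2).add ((hasFDerivAt_gam 1 x).pow 2)).add
    ((hasFDerivAt_gam 2 x).pow 2)
  have := h.fderiv
  change fderiv ℝ F₂ x = _ at this
  rw [this]
  simp [gam]
  ring

lemma fderiv_H₂ (X Z : ℝ) (x v : Phase) :
    fderiv ℝ (H₂ X Z) x v = X * mom v 0 + Z * mom v 2 := by
  have h := ((hasFDerivAt_mom 0 x).const_mul X).add ((hasFDerivAt_mom 2 x).const_mul Z)
  have := h.fderiv
  change fderiv ℝ (H₂ X Z) x = _ at this
  rw [this]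
  simp [mom]

lemma fderiv_H₁ (I X Z : ℝ) (x v : Phase) : fderiv ℝ (H₁ I X Z) x v =
    (mom x 0 * mom v 0 + mom x 1 * mom v 1 + mom x 2 * mom v 2) / I +
      (X * gam v 0 + Z * gam v 2) := by
  have h := (((((hasFDerivAt_mom 0 x).pow 2).add ((hasFDerivAt_mom 1 x).pow 2)).add
    ((hasFDerivAt_mom 2 x).pow 2)).mul_const (2 * I)⁻¹).add
    (((hasFDerivAt_gam 0 x).const_mul X).add ((hasFDerivAt_gam 2 x).const_mul Z))
  have := h.fderiv
  change fderiv ℝ (H₁ I X Z) x = _ at this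
  rw [this]
  simp [mom, gam]
  ring

/-! ### The Poisson bracket in coordinates -/

/-- The bracket as a bilinear expression in the differentials. -/
lemma bracket_eq (f g : Phase → ℝ) (x : Phase) : bracket f g x =
    mom x 2 * (partialD (.inl 1) f x * partialD (.inl 0) g x
        - partialD (.inl 0) f x * partialD (.inl 1) g x) +
    mom x 0 * (partialD (.inl 2) f x * partialD (.inl 1) g x
        - partialD (.inl 1) f x * partialD (.inl 2) g x) +
    mom x 1 * (partialD (.inl 0) f x * partialD (.inl 2) g x
        - partialD (.inl 2) f x * partialD (.inl 0) g x) +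
    gam x 2 * (partialD (.inl 1) f x * partialD (.inr 0) g x
        - partialD (.inl 0) f x * partialD (.inr 1) g x
        - partialD (.inr 0) f x * partialD (.inl 1) g x
        + partialD (.inr 1) f x * partialD (.inl 0) g x) +
    gam x 0 * (partialD (.inl 2) f x * partialD (.inr 1) g x
        - partialD (.inl 1) f x * partialD (.inr 2) g x
        - partialD (.inr 1) f x * partialD (.inl 2) g x
        + partialD (.inr 2) f x * partialD (.inl 1) g x) +
    gam x 1 * (partialD (.inl 0) f x * partialD (.inr 2) g x
        - partialD (.inl 2) f x * partialD (.inr 0) g x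
        - partialD (.inr 2) f x * partialD (.inl 0) g x
        + partialD (.inr 0) f x * partialD (.inl 2) g x) := by
  simp only [bracket, Fintype.sum_sum_type, Fin.sum_univ_three, poissonMatrix, eps]
  norm_num
  ring

lemma mom_single_inl (i j : Fin 3) : mom (Pi.single (.inl i) 1) j = if j = i then 1 else 0 := by
  simp [mom, Pi.single_apply]

lemma mom_single_inr (i j : Fin 3) : mom (Pi.single (.inr i) 1) j = 0 := by
  simp [mom]

lemma gam_single_inl (i j : Fin 3) : gam (Pi.single (.inl i) 1) j = 0 := by
  simp [gam]

lemma gam_single_inr (i j : Fin 3) : gam (Pi.single (.inr i) 1) j = if j = i then 1 else 0 := by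
  simp [gam, Pi.single_apply]

lemma partialD_coord (p q : Fin 3 ⊕ Fin 3) (x : Phase) :
    partialD p (fun y => y q) x = if q = p then 1 else 0 := by
  rw [partialD, (hasFDerivAt_coord q x).fderiv]
  simp [Pi.single_apply]

lemma partialD_add {f g : Phase → ℝ} (hf : ContDiff ℝ ∞ f) (hg : ContDiff ℝ ∞ g)
    (p : Fin 3 ⊕ Fin 3) (x : Phase) :
    partialD p (fun y => f y + g y) x = partialD p f x + partialD p g x := by
  have := ((differentiableAt_of_smooth hf x).hasFDerivAt.add
    (differentiableAt_of_smooth hg x).hasFDerivAt).fderiv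
  change fderiv ℝ (fun y => f y + g y) x = _ at this
  simp [partialD, this]

lemma partialD_mul {f g : Phase → ℝ} (hf : ContDiff ℝ ∞ f) (hg : ContDiff ℝ ∞ g)
    (p : Fin 3 ⊕ Fin 3) (x : Phase) :
    partialD p (fun y => f y * g y) x = f x * partialD p g x + g x * partialD p f x := by
  have := ((differentiableAt_of_smooth hf x).hasFDerivAt.mul
    (differentiableAt_of_smooth hg x).hasFDerivAt).fderiv
  change fderiv ℝ (fun y => f y * g y) x = _ at this
  simp [partialD, this]

/-! ### Independence of the differentials -/

/-- `(X₀, 0, Z₀) · (Γ × M)`. -/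
def tripleDet (X Z : ℝ) (x : Phase) : ℝ :=
  mom x 1 * (Z * gam x 0 - X * gam x 2) - (Z * mom x 0 - X * mom x 2) * gam x 1

/-- A function with differential in `dH₁ + span (dF₁, dF₂, dH₂)` completes `F₁, F₂, H₂` to an
independent family wherever the axis, `Γ` and `M` are linearly independent. -/
lemma independentAt_of_tripleDet_ne_zero {I X Z : ℝ} {H : Phase → ℝ} {x : Phase} (hI : I ≠ 0)
    (α β δ : ℝ)
    (hH : ∀ v, fderiv ℝ H x v = fderiv ℝ (H₁ I X Z) x v + α * fderiv ℝ F₁ x v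
      + β * fderiv ℝ F₂ x v + δ * fderiv ℝ (H₂ X Z) x v)
    (hx : tripleDet X Z x ≠ 0) : IndependentAt ![F₁, F₂, H, H₂ X Z] x := by
  rw [IndependentAt, Fintype.linearIndependent_iff]
  intro c hc
  have key : ∀ v, c 0 * fderiv ℝ F₁ x v + c 1 * fderiv ℝ F₂ x v + c 2 * fderiv ℝ H x v
      + c 3 * fderiv ℝ (H₂ X Z) x v = 0 := by
    intro v
    have := congrArg (fun L : Phase →L[ℝ] ℝ => L v) hc
    simpa [Fin.sum_univ_four] using this
  have h0 := key (Pi.single (.inl 0) 1)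
  have h1 := key (Pi.single (.inl 1) 1)
  have h2 := key (Pi.single (.inl 2) 1)
  have g0 := key (Pi.single (.inr 0) 1)
  have g1 := key (Pi.single (.inr 1) 1)
  have g2 := key (Pi.single (.inr 2) 1)
  simp [hH, fderiv_F₁, fderiv_F₂, fderiv_H₁, fderiv_H₂, mom_single_inl, mom_single_inr,
    gam_single_inl, gam_single_inr] at h0 h1 h2 g0 g1 g2

  unfold tripleDet at hx
  -- With `n = (X, 0, Z)`, the `M`-components of the relation read `(c₀ + αc₂)Γ + (c₂/I)M + (c₃ +
  -- δc₂)n = 0`. Pairing with `M × n`, `n × Γ` and `Γ × M` isolates one coefficient at a time,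
  -- multiplied by the triple product.
  have hA : c 0 + α * c 2 = 0 := by
    refine (mul_eq_zero.mp ?_).resolve_right hx
    linear_combination (mom x 1 * Z) * h0 + (mom x 2 * X - mom x 0 * Z) * h1 - (mom x 1 * X) * h2
  have hC : c 2 = 0 := by
    have : c 2 / I = 0 := by
      refine (mul_eq_zero.mp ?_).resolve_right hx
      linear_combination -(gam x 1 * Z) * h0 - (gam x 2 * X - gam x 0 * Z) * h1
        + (gam x 1 * X) * h2
    simpa [hI] using this
  have hE : c 3 + δ * c 2 = 0 := by
    refine (mul_eq_zero.mp ?_).resolve_right hx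
    linear_combination (gam x 1 * mom x 2 - gam x 2 * mom x 1) * h0
      + (gam x 2 * mom x 0 - gam x 0 * mom x 2) * h1
      + (gam x 0 * mom x 1 - gam x 1 * mom x 0) * h2
  -- The `Γ`-components read `(c₀ + αc₂)M + 2(c₁ + βc₂)Γ + c₂n = 0`; pairing with `M × n` leaves the
  -- middle term.
  have hB : c 1 + β * c 2 = 0 := by
    have : 2 * (c 1 + β * c 2) = 0 := by
      refine (mul_eq_zero.mp ?_).resolve_right hx
      linear_combination (mom x 1 * Z) * g0 + (mom x 2 * X - mom x 0 * Z) * g1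
        - (mom x 1 * X) * g2
    linarith
  rw [hC] at hA hB hE
  intro i
  fin_cases i <;> simp <;> linarith

/-! ### Density of the independent points -/

lemma continuous_toPhase {a b : ℝ → Fin 3 → ℝ} (ha : Continuous a) (hb : Continuous b) :
    Continuous fun t => (Sum.elim (a t) (b t) : Phase) := by
  refine continuous_pi ?_
  rintro (i | i)
  · exact (continuous_apply i).comp ha
  · exact (continuous_apply i).comp hb

lemma mem_closure_of_curve {S : Set Phase} {φ : ℝ → Phase} (hφ : Continuous φ) {δ : ℝ}
    (hδ : 0 < δ) (hS : ∀ t, 0 < t → t < δ → φ t ∈ S) : φ 0 ∈ closure S := by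
  have h : Tendsto φ (𝓝[>] 0) (𝓝 (φ 0)) := hφ.continuousAt.tendsto.mono_left nhdsWithin_le_nhds
  refine mem_closure_of_tendsto h ?_
  filter_upwards [Ioo_mem_nhdsGT hδ] with t ht using hS t ht.1 ht.2

/-- The square of the norm of `(X₀, 0, Z₀) × Γ`. -/
def crossSq (X Z : ℝ) (x : Phase) : ℝ :=
  (Z * gam x 0 - X * gam x 2) ^ 2 + (X ^ 2 + Z ^ 2) * gam x 1 ^ 2

lemma normSq_pos {X Z : ℝ} (h : X ≠ 0 ∨ Z ≠ 0) : 0 < X ^ 2 + Z ^ 2 := by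
  rcases h with h | h <;> positivity

/-- Where `Γ` is parallel to the axis, rotating `M` and `Γ` together about the second coordinate
direction, which is orthogonal to the axis, stays in the leaf and tilts `Γ` away at once. -/
lemma leaf_subset_closure_crossSq {X Z : ℝ} (hXZ : X ≠ 0 ∨ Z ≠ 0) {c₁ c₂ : ℝ} (hc : 0 < c₂) :
    leaf c₁ c₂ ⊆ closure {x | x ∈ leaf c₁ c₂ ∧ crossSq X Z x ≠ 0} := by
  intro x hx
  by_cases h : crossSq X Z x = 0
  swap
  · exact subset_closure ⟨hx, h⟩
  have hN := normSq_pos hXZ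
  have hG1 : gam x 1 = 0 := by
    have : gam x 1 ^ 2 = 0 := by
      unfold crossSq at h
      nlinarith [sq_nonneg (Z * gam x 0 - X * gam x 2), sq_nonneg (gam x 1),
        mul_nonneg hN.le (sq_nonneg (gam x 1))]
    simpa using this
  have hg : Z * gam x 0 - X * gam x 2 = 0 := by
    have : (Z * gam x 0 - X * gam x 2) ^ 2 = 0 := by
      unfold crossSq at h
      rw [hG1] at h
      linarith
    simpa using this
  -- By Lagrange's identity `|n|²|Γ|²` is the sum of the squares of cross and dot product; `Γ ≠ 0`
  -- is parallel to `n`, so the dot product survives.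
  have hu : X * gam x 0 + Z * gam x 2 ≠ 0 := by
    intro hu
    have h2 := hx.2
    unfold F₂ at h2
    have : (X ^ 2 + Z ^ 2) * c₂ = 0 := by
      rw [← h2, hG1]
      linear_combination (Z * gam x 0 - X * gam x 2) * hg + (X * gam x 0 + Z * gam x 2) * hu
    exact (mul_pos hN hc).ne' this
  let φ : ℝ → Phase := fun t => Sum.elim
    ![Real.cos t * mom x 0 + Real.sin t * mom x 2, mom x 1,
      -Real.sin t * mom x 0 + Real.cos t * mom x 2]
    ![Real.cos t * gam x 0 + Real.sin t * gam x 2, gam x 1,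
      -Real.sin t * gam x 0 + Real.cos t * gam x 2]
  have hφ : Continuous φ := by
    apply continuous_toPhase <;> fun_prop
  have h0 : φ 0 = x := by
    ext p
    rcases p with i | i <;> fin_cases i <;> simp [φ, mom, gam]
  rw [← h0]
  refine mem_closure_of_curve hφ Real.pi_pos fun t ht ht' => ⟨⟨?_, ?_⟩, ?_⟩
  · rw [← hx.1]
    simp only [F₁, mom, gam, φ]
    simp
    linear_combination (x (.inl 0) * x (.inr 0) + x (.inl 2) * x (.inr 2))
      * Real.sin_sq_add_cos_sq t
  · rw [← hx.2]
    simp only [F₂, mom, gam, φ]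
    simp
    linear_combination (x (.inr 0) ^ 2 + x (.inr 2) ^ 2) * Real.sin_sq_add_cos_sq t
  · have : crossSq X Z (φ t) = (Real.sin t * (X * gam x 0 + Z * gam x 2)) ^ 2 := by
      have h1 : gam (φ t) 0 = Real.cos t * gam x 0 + Real.sin t * gam x 2 := rfl
      have h2 : gam (φ t) 1 = gam x 1 := rfl
      have h3 : gam (φ t) 2 = -Real.sin t * gam x 0 + Real.cos t * gam x 2 := rfl
      rw [crossSq, h1, h2, h3, hG1]
      have : Z * (Real.cos t * gam x 0 + Real.sin t * gam x 2)
          - X * (-Real.sin t * gam x 0 + Real.cos t * gam x 2)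
          = Real.sin t * (X * gam x 0 + Z * gam x 2) := by
        linear_combination Real.cos t * hg
      rw [this]; ring
    rw [this]
    exact pow_ne_zero _ (mul_ne_zero (Real.sin_pos_of_pos_of_lt_pi ht ht').ne' hu)

/-- Keep `Γ` and move `M` along `n × Γ`: this is orthogonal to `Γ`, so `F₁` is unchanged, while the
triple product grows linearly with slope `|n × Γ|²`. -/
lemma leaf_crossSq_subset_closure (X Z c₁ c₂ : ℝ) :
    {x | x ∈ leaf c₁ c₂ ∧ crossSq X Z x ≠ 0} ⊆
      closure {x | x ∈ leaf c₁ c₂ ∧ tripleDet X Z x ≠ 0} := by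
  rintro x ⟨hx, hc⟩
  by_cases h : tripleDet X Z x = 0
  swap
  · exact subset_closure ⟨hx, h⟩
  let φ : ℝ → Phase := fun t => Sum.elim
    ![mom x 0 - t * (Z * gam x 1), mom x 1 + t * (Z * gam x 0 - X * gam x 2),
      mom x 2 + t * (X * gam x 1)]
    ![gam x 0, gam x 1, gam x 2]
  have hφ : Continuous φ := by
    apply continuous_toPhase <;> fun_prop
  have h0 : φ 0 = x := by
    ext p
    rcases p with i | i <;> fin_cases i <;> simp [φ, mom, gam]
  rw [← h0]
  refine mem_closure_of_curve hφ one_pos fun t ht _ => ⟨⟨?_, ?_⟩, ?_⟩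
  · rw [← hx.1]
    simp only [F₁, mom, gam, φ]
    simp
    ring
  · rw [← hx.2]
    simp [F₂, gam, φ]
  · have : tripleDet X Z (φ t) = tripleDet X Z x + t * crossSq X Z x := by
      simp only [tripleDet, crossSq, mom, gam, φ]
      simp
      ring
    rw [this, h, zero_add]
    exact mul_ne_zero ht.ne' hc

lemma leaf_subset_closure_tripleDet {X Z : ℝ} (hXZ : X ≠ 0 ∨ Z ≠ 0) {c₁ c₂ : ℝ} (hc : 0 < c₂) :
    leaf c₁ c₂ ⊆ closure {x | x ∈ leaf c₁ c₂ ∧ tripleDet X Z x ≠ 0} :=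
  (leaf_subset_closure_crossSq hXZ hc).trans
    (closure_minimal (leaf_crossSq_subset_closure X Z c₁ c₂) isClosed_closure)

lemma dense_tripleDet {X Z : ℝ} (hXZ : X ≠ 0 ∨ Z ≠ 0) : Dense {x | tripleDet X Z x ≠ 0} := by
  have hpos : ∀ x, 0 < F₂ x → x ∈ closure {x | tripleDet X Z x ≠ 0} := fun x hx =>
    closure_mono (fun _ h => h.2) (leaf_subset_closure_tripleDet hXZ hx
      (show x ∈ leaf (F₁ x) (F₂ x) from ⟨rfl, rfl⟩))
  intro x
  by_cases h : 0 < F₂ x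
  · exact hpos x h
  have hg : gam x 0 = 0 ∧ gam x 1 = 0 ∧ gam x 2 = 0 := by
    unfold F₂ at h
    refine ⟨?_, ?_, ?_⟩ <;>
      nlinarith [sq_nonneg (gam x 0), sq_nonneg (gam x 1), sq_nonneg (gam x 2)]
  let φ : ℝ → Phase := fun t => Sum.elim ![mom x 0, mom x 1, mom x 2] ![t, 0, 0]
  have hφ : Continuous φ := by
    apply continuous_toPhase <;> fun_prop
  have h0 : φ 0 = x := by
    ext p
    have h0 := hg.1
    have h1 := hg.2.1
    have h2 := hg.2.2
    simp only [gam] at h0 h1 h2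
    rcases p with i | i <;> fin_cases i <;> simp [φ, mom, h0, h1, h2]
  -- Points with `Γ = 0` lie on no leaf with `c₂ > 0`; they are limits of points with `Γ ≠ 0`, which
  -- are already in the closure.
  rw [← h0, ← closure_closure]
  refine mem_closure_of_curve hφ one_pos fun t ht _ => hpos _ ?_
  simp only [F₂, gam, φ]
  simp
  positivity

/-! ### Liouville integrability, cases (i)–(iii) -/

/-- Liouville integrability of any system with Hamiltonian `H₁ + f(F₁, F₂, H₂)`, expressed through
the differential of the Hamiltonian. -/
lemma isLiouvilleIntegrable_of_hamiltonian {I X Z : ℝ} (hI : I ≠ 0) (hXZ : X ≠ 0 ∨ Z ≠ 0)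
    {H : Phase → ℝ} (hH : ContDiff ℝ ∞ H) (α β a : Phase → ℝ)
    (hD : ∀ x v, fderiv ℝ H x v = fderiv ℝ (H₁ I X Z) x v + α x * fderiv ℝ F₁ x v
      + β x * fderiv ℝ F₂ x v + a x * fderiv ℝ (H₂ X Z) x v) :
    IsLiouvilleIntegrable (system I X Z a) := by
  refine ⟨H, H₂ X Z, hH, contDiff_H₂ X Z, ?_, ?_, ?_⟩
  · intro x p
    rw [bracket_eq]
    simp only [partialD_coord]
    simp only [partialD, hD, fderiv_F₁, fderiv_F₂, fderiv_H₁, fderiv_H₂, mom_single_inl,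
      mom_single_inr, gam_single_inl, gam_single_inr]
    rcases p with i | i <;> fin_cases i <;> simp [system] <;> ring
  · intro i j x
    rw [bracket_eq]
    fin_cases i <;> fin_cases j <;>
      simp [partialD, hD, fderiv_F₁, fderiv_F₂, fderiv_H₁, fderiv_H₂, mom_single_inl,
        mom_single_inr, gam_single_inl, gam_single_inr, -mul_eq_zero] <;> ring
  · intro c₁ c₂ hc
    exact (leaf_subset_closure_tripleDet hXZ hc).trans (closure_mono fun x hx =>
      ⟨hx.1, independentAt_of_tripleDet_ne_zero hI _ _ _ (hD x) hx.2⟩)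

lemma fderiv_add_mul {f g h : Phase → ℝ} (hf : ContDiff ℝ ∞ f) (hg : ContDiff ℝ ∞ g)
    (hh : ContDiff ℝ ∞ h) (x v : Phase) : fderiv ℝ (fun y => f y + g y * h y) x v =
      fderiv ℝ f x v + g x * fderiv ℝ h x v + h x * fderiv ℝ g x v := by
  have := ((differentiableAt_of_smooth hf x).hasFDerivAt.add
    ((differentiableAt_of_smooth hg x).hasFDerivAt.mul
      (differentiableAt_of_smooth hh x).hasFDerivAt)).fderiv
  change fderiv ℝ (fun y => f y + g y * h y) x = _ at this
  simp [this]
  ring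

lemma isLiouvilleIntegrable_aI {I X Z : ℝ} (hI : I ≠ 0) (hXZ : X ≠ 0 ∨ Z ≠ 0) :
    IsLiouvilleIntegrable (system I X Z aI) := by
  refine isLiouvilleIntegrable_of_hamiltonian hI hXZ
    (H := fun x => H₁ I X Z x + F₁ x * H₂ X Z x) (by fun_prop) (H₂ X Z) 0 aI fun x v => ?_
  rw [fderiv_add_mul (by fun_prop) (by fun_prop) (by fun_prop)]
  change _ + F₁ x * _ + _ = _ + _ + 0 * _ + F₁ x * _
  ring

lemma isLiouvilleIntegrable_aII {I X Z : ℝ} (hI : I ≠ 0) (hXZ : X ≠ 0 ∨ Z ≠ 0) :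
    IsLiouvilleIntegrable (system I X Z aII) := by
  refine isLiouvilleIntegrable_of_hamiltonian hI hXZ
    (H := fun x => H₁ I X Z x + F₂ x * H₂ X Z x) (by fun_prop) 0 (H₂ X Z) aII fun x v => ?_
  rw [fderiv_add_mul (by fun_prop) (by fun_prop) (by fun_prop)]
  change _ + F₂ x * _ + _ = _ + 0 * _ + _ + F₂ x * _
  ring

/-- Here `d(H₂²/2) = H₂ dH₂` gives the required multiple of `dH₂` with no Casimir terms. -/
lemma isLiouvilleIntegrable_aIII {I X Z : ℝ} (hI : I ≠ 0) (hXZ : X ≠ 0 ∨ Z ≠ 0) :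
    IsLiouvilleIntegrable (system I X Z (aIII X Z)) := by
  refine isLiouvilleIntegrable_of_hamiltonian hI hXZ
    (H := fun x => H₁ I X Z x + (1 / 2 * H₂ X Z x) * H₂ X Z x) (by fun_prop) 0 0 (aIII X Z)
    fun x v => ?_
  have h : fderiv ℝ (fun y => 1 / 2 * H₂ X Z y) x v = 1 / 2 * fderiv ℝ (H₂ X Z) x v := by
    have := ((differentiableAt_of_smooth (contDiff_H₂ X Z) x).hasFDerivAt.const_mul (1 / 2)).fderiv
    change fderiv ℝ (fun y => 1 / 2 * H₂ X Z y) x = _ at this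
    rw [this]; rfl
  rw [fderiv_add_mul (by fun_prop) (by fun_prop) (by fun_prop), h]
  change _ = _ + 0 * _ + 0 * _ + H₂ X Z x * _
  ring

/-! ### First integrals and the invariant measure -/

lemma fderiv_system_F₁ (I X Z : ℝ) (a : Phase → ℝ) (x : Phase) :
    fderiv ℝ F₁ x (system I X Z a x) = 0 := by
  rw [fderiv_F₁]; simp [system, mom, gam]; ring

lemma fderiv_system_F₂ (I X Z : ℝ) (a : Phase → ℝ) (x : Phase) :
    fderiv ℝ F₂ x (system I X Z a x) = 0 := by
  rw [fderiv_F₂]; simp [system, gam, mom]; ring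

lemma fderiv_system_H₁ (I X Z : ℝ) (a : Phase → ℝ) (x : Phase) :
    fderiv ℝ (H₁ I X Z) x (system I X Z a x) = 0 := by
  rw [fderiv_H₁]; simp [system, mom, gam]; ring

lemma fderiv_system_H₂ (I X Z : ℝ) (a : Phase → ℝ) (x : Phase) :
    fderiv ℝ (H₂ X Z) x (system I X Z a x) = 0 := by
  rw [fderiv_H₂]; simp [system, mom, gam]; ring

lemma isFirstIntegral_system (I X Z : ℝ) (a : Phase → ℝ) (i : Fin 4) :
    IsFirstIntegral (system I X Z a) (![F₁, F₂, H₁ I X Z, H₂ X Z] i) := by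
  fin_cases i
  · exact ⟨contDiff_F₁, fderiv_system_F₁ I X Z a⟩
  · exact ⟨contDiff_F₂, fderiv_system_F₂ I X Z a⟩
  · exact ⟨contDiff_H₁ I X Z, fderiv_system_H₁ I X Z a⟩
  · exact ⟨contDiff_H₂ X Z, fderiv_system_H₂ I X Z a⟩

lemma dense_independentAt {I X Z : ℝ} (hI : I ≠ 0) (hXZ : X ≠ 0 ∨ Z ≠ 0) :
    Dense {x | IndependentAt ![F₁, F₂, H₁ I X Z, H₂ X Z] x} :=
  (dense_tripleDet hXZ).mono fun x hx =>
    independentAt_of_tripleDet_ne_zero hI 0 0 0 (fun v => by ring) hx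

lemma contDiff_system (I X Z : ℝ) {a : Phase → ℝ} (ha : ContDiff ℝ ∞ a) :
    ContDiff ℝ ∞ (system I X Z a) := by
  refine contDiff_pi.mpr ?_
  rintro (i | i) <;> fin_cases i <;> simp [system] <;> fun_prop

lemma partialD_eq_zero {f : Phase → ℝ} (hf : ContDiff ℝ ∞ f) {p : Fin 3 ⊕ Fin 3} {x : Phase}
    (h : ∀ t : ℝ, f (x + t • Pi.single p 1) = f x) : partialD p f x = 0 := by
  have hd := (differentiableAt_of_smooth hf x).lineDeriv_eq_fderiv (v := Pi.single p 1)
  rw [partialD, ← hd, lineDeriv]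
  simp [h]

/-- Each component of the field is `c + a d` with `c` and `d` independent of its own coordinate, so
only the derivative of `a` enters the divergence. -/
lemma partialD_affine {f c a d : Phase → ℝ} (ha : ContDiff ℝ ∞ a) (hc : ContDiff ℝ ∞ c)
    (hd : ContDiff ℝ ∞ d) (hf : ∀ y, f y = c y + a y * d y) {p : Fin 3 ⊕ Fin 3} {x : Phase}
    (hc' : ∀ t : ℝ, c (x + t • Pi.single p 1) = c x)
    (hd' : ∀ t : ℝ, d (x + t • Pi.single p 1) = d x) :
    partialD p f x = d x * partialD p a x := by
  obtain rfl : f = fun y => c y + a y * d y := funext hf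
  rw [partialD_add hc (ha.mul hd), partialD_mul ha hd, partialD_eq_zero hc hc',
    partialD_eq_zero hd hd']
  ring

/-- The divergence of the system is the derivative of `a` along the rotation generated by `H₂`. -/
lemma preservesStandardMeasure_system (I X Z : ℝ) {a : Phase → ℝ} (ha : ContDiff ℝ ∞ a)
    (h : ∀ x, Z * mom x 1 * partialD (.inl 0) a x
      + (X * mom x 2 - Z * mom x 0) * partialD (.inl 1) a x - X * mom x 1 * partialD (.inl 2) a x
      + Z * gam x 1 * partialD (.inr 0) a x
      + (X * gam x 2 - Z * gam x 0) * partialD (.inr 1) a x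
      - X * gam x 1 * partialD (.inr 2) a x = 0) :
    PreservesStandardMeasure (system I X Z a) := by
  refine ⟨contDiff_system I X Z ha, fun x => ?_⟩
  have h0 := partialD_affine (f := fun y => system I X Z a y (.inl 0)) (p := .inl 0) (x := x) ha
    (c := fun y => Z * gam y 1) (d := fun y => Z * mom y 1)
    (by fun_prop) (by fun_prop) (fun y => by simp [system]; ring)
    (by intro t; simp [gam]) (by intro t; simp [mom])
  have h1 := partialD_affine (f := fun y => system I X Z a y (.inl 1)) (p := .inl 1) (x := x) ha
    (c := fun y => X * gam y 2 - Z * gam y 0) (d := fun y => X * mom y 2 - Z * mom y 0)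
    (by fun_prop) (by fun_prop) (fun y => by simp [system])
    (by intro t; simp [gam]) (by intro t; simp [mom])
  have h2 := partialD_affine (f := fun y => system I X Z a y (.inl 2)) (p := .inl 2) (x := x) ha
    (c := fun y => -X * gam y 1) (d := fun y => -X * mom y 1)
    (by fun_prop) (by fun_prop) (fun y => by simp [system]; ring)
    (by intro t; simp [gam]) (by intro t; simp [mom])
  have g0 := partialD_affine (f := fun y => system I X Z a y (.inr 0)) (p := .inr 0) (x := x) ha
    (c := fun y => (gam y 1 * mom y 2 - gam y 2 * mom y 1) / I) (d := fun y => Z * gam y 1)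
    (by fun_prop) (by fun_prop) (fun y => by simp [system]; ring)
    (by intro t; simp [mom, gam]) (by intro t; simp [gam])
  have g1 := partialD_affine (f := fun y => system I X Z a y (.inr 1)) (p := .inr 1) (x := x) ha
    (c := fun y => (gam y 2 * mom y 0 - gam y 0 * mom y 2) / I) (d := fun y => X * gam y 2 - Z * gam y 0)
    (by fun_prop) (by fun_prop) (fun y => by simp [system])
    (by intro t; simp [mom, gam]) (by intro t; simp [gam])
  have g2 := partialD_affine (f := fun y => system I X Z a y (.inr 2)) (p := .inr 2) (x := x) ha
    (c := fun y => (gam y 0 * mom y 1 - gam y 1 * mom y 0) / I) (d := fun y => -X * gam y 1)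
    (by fun_prop) (by fun_prop) (fun y => by simp [system]; ring)
    (by intro t; simp [mom, gam]) (by intro t; simp [gam])
  simp only [Fintype.sum_sum_type, Fin.sum_univ_three, h0, h1, h2, g0, g1, g2]
  linear_combination h x

@[fun_prop] lemma contDiff_aIV (X Z : ℝ) : ContDiff ℝ ∞ (aIV X Z) := by unfold aIV; fun_prop

@[fun_prop] lemma contDiff_aV : ContDiff ℝ ∞ aV := by unfold aV; fun_prop

lemma preservesStandardMeasure_aIV (I X Z : ℝ) :
    PreservesStandardMeasure (system I X Z (aIV X Z)) := by
  refine preservesStandardMeasure_system I X Z (contDiff_aIV X Z) fun x => ?_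
  have h : ∀ v, fderiv ℝ (aIV X Z) x v = X * gam v 0 + Z * gam v 2 := by
    intro v
    have := (((hasFDerivAt_gam 0 x).const_mul X).add ((hasFDerivAt_gam 2 x).const_mul Z)).fderiv
    change fderiv ℝ (aIV X Z) x = _ at this
    rw [this]
    simp [gam]
  simp [partialD, h, gam_single_inl, gam_single_inr]
  ring

lemma preservesStandardMeasure_aV (I X Z : ℝ) : PreservesStandardMeasure (system I X Z aV) := by
  refine preservesStandardMeasure_system I X Z contDiff_aV fun x => ?_
  have h : ∀ v, fderiv ℝ aV x v =
      2 * (mom x 0 * mom v 0 + mom x 1 * mom v 1 + mom x 2 * mom v 2) := by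
    intro v
    have := ((((hasFDerivAt_mom 0 x).pow 2).add ((hasFDerivAt_mom 1 x).pow 2)).add
      ((hasFDerivAt_mom 2 x).pow 2)).fderiv
    change fderiv ℝ aV x = _ at this
    rw [this]
    simp [mom]
    ring
  simp [partialD, h, mom_single_inl, mom_single_inr]
  ring

/-! ### Calculus of functions obtained by quadratures -/

namespace ByQuadratures

variable {U : Set ℝ} {f g : ℝ → ℝ}

lemma continuousOn (hf : ByQuadratures U f) : ContinuousOn f U := by
  induction hf with
  | const U c => exact continuousOn_const
  | ident U => exact continuousOn_id
  | add _ _ ihf ihg => exact ihf.add ihg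
  | mul _ _ ihf ihg => exact ihf.mul ihg
  | algebraic n c hc hf hroot hsimple ih => exact hf
  | comp hV hg hf hmaps ihg ihf => exact ihg.comp ihf hmaps
  | inverse hV hg hg' hf hmaps hinv ih => exact hf
  | quadrature hf hF ih => exact fun t ht => (hF t ht).continuousAt.continuousWithinAt

/-- `g` is the simple root of the linear equation `-f + g = 0`. Only values on `U` matter, so
formulas valid on `U` alone can be used freely. -/
lemma congr (hf : ByQuadratures U f) (h : ∀ t ∈ U, f t = g t) : ByQuadratures U g := by
  refine algebraic 1 ![fun t => -1 * f t, fun _ => 1] ?_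
    (hf.continuousOn.congr fun t ht => (h t ht).symm) ?_ ?_
  · intro k
    fin_cases k
    · exact (const U (-1)).mul hf
    · exact const U 1
  · intro t ht
    simp [Fin.sum_univ_two, h t ht]
  · intro t ht
    simp [Fin.sum_univ_two]

lemma mono {V : Set ℝ} (hf : ByQuadratures V f) (hV : IsOpen V) (h : U ⊆ V) :
    ByQuadratures U f :=
  comp hV hf (ident U) h

lemma const_mul (c : ℝ) (hf : ByQuadratures U f) : ByQuadratures U fun t => c * f t :=
  (const U c).mul hf

lemma sub (hf : ByQuadratures U f) (hg : ByQuadratures U g) :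
    ByQuadratures U fun t => f t - g t :=
  (hf.add (hg.const_mul (-1))).congr fun t _ => by ring

lemma div (hf : ByQuadratures U f) (hg : ByQuadratures U g) (h : ∀ t ∈ U, g t ≠ 0) :
    ByQuadratures U fun t => f t / g t := by
  refine algebraic 1 ![fun t => -1 * f t, g] ?_ (hf.continuousOn.div hg.continuousOn h) ?_ ?_
  · intro k
    fin_cases k
    · exact (const U (-1)).mul hf
    · exact hg
  · intro t ht
    have := h t ht
    simp [Fin.sum_univ_two]
    field_simp
    ring
  · intro t ht
    simpa [Fin.sum_univ_two] using h t ht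

/-- A continuous, nowhere vanishing square root. -/
lemma of_sq (hf : ByQuadratures U f) (hg : ContinuousOn g U) (h : ∀ t ∈ U, g t ^ 2 = f t)
    (h0 : ∀ t ∈ U, g t ≠ 0) : ByQuadratures U g := by
  refine algebraic 2 ![fun t => -1 * f t, fun _ => 0, fun _ => 1] ?_ hg ?_ ?_
  · intro k
    fin_cases k
    · exact (const U (-1)).mul hf
    · exact const U 0
    · exact const U 1
  · intro t ht
    simp [Fin.sum_univ_three, h t ht]
  · intro t ht
    simpa [Fin.sum_univ_three] using h0 t ht

lemma arctan : ByQuadratures Set.univ Real.arctan :=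
  quadrature (f := fun t => 1 / (1 + t * t))
    ((const _ 1).div ((const _ 1).add ((ident _).mul (ident _))) fun t _ => by nlinarith [mul_self_nonneg t])
    fun t _ => by simpa [sq] using Real.hasDerivAt_arctan t

lemma tan : ByQuadratures (Set.Ioo (-(Real.pi / 2)) (Real.pi / 2)) Real.tan :=
  inverse isOpen_univ arctan (fun s _ => by rw [Real.deriv_arctan]; positivity)
    (Real.continuousOn_tan_Ioo) (fun _ _ => trivial)
    fun t ht => Real.arctan_tan ht.1 ht.2

/-- Recovering a plane curve from its squared norm and its angular momentum. -/
lemma polar {p q p' q' D B : ℝ → ℝ} (hp : ∀ t ∈ U, HasDerivAt p (p' t) t)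
    (hq : ∀ t ∈ U, HasDerivAt q (q' t) t) (hD : ByQuadratures U D) (hB : ByQuadratures U B)
    (hpD : ∀ t ∈ U, p t ^ 2 + q t ^ 2 = D t) (hpB : ∀ t ∈ U, p t * q' t - q t * p' t = B t)
    (h0 : ∀ t ∈ U, p t ≠ 0) : ByQuadratures U p ∧ ByQuadratures U q := by
  have hD0 : ∀ t ∈ U, D t ≠ 0 := fun t ht => by
    have := h0 t ht
    rw [← hpD t ht]; positivity
  -- The polar angle has derivative (angular momentum)/(squared norm). Its tangent gives the ratio
  -- `q / p`, and then `p² = D / (1 + (q/p)²)`.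
  have hψ : ByQuadratures U fun t => Real.arctan (q t / p t) := by
    refine quadrature (hB.div hD hD0) fun t ht => ?_
    have hd := ((hq t ht).div (hp t ht) (h0 t ht)).arctan
    change HasDerivAt (fun t => Real.arctan (q t / p t)) (1 / (1 + (q t / p t) ^ 2) * _) t at hd
    convert hd using 1
    have := h0 t ht
    have h1 := hD0 t ht
    rw [← hpB t ht]
    rw [← hpD t ht] at h1 ⊢
    field_simp
  have hr : ByQuadratures U fun t => q t / p t :=
    (comp isOpen_Ioo tan hψ fun t _ => Real.arctan_mem_Ioo _).congr fun t _ => Real.tan_arctan _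
  have hpc : ContinuousOn p U := fun t ht => (hp t ht).continuousAt.continuousWithinAt
  have hp' : ByQuadratures U p := by
    refine of_sq (hD.div ((const U 1).add (hr.mul hr)) fun t _ => ?_) hpc (fun t ht => ?_) h0
    · nlinarith [sq_nonneg (q t / p t)]
    · have := h0 t ht
      have h1 : p t ^ 2 + q t ^ 2 ≠ 0 := by positivity
      rw [← hpD t ht]
      field_simp
  refine ⟨hp', (hr.mul hp').congr fun t ht => ?_⟩
  have := h0 t ht
  field_simp

/-- A solution of `(u̇)² = R(u)` is obtained by quadratures near a time at which it moves. -/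
lemma of_autonomous {W : Set ℝ} (hW : IsOpen W) {u v R : ℝ → ℝ}
    (hu : ∀ t ∈ W, HasDerivAt u (v t) t) (hv : ContinuousOn v W)
    (hR : ByQuadratures Set.univ R) (huv : ∀ t ∈ W, v t ^ 2 = R (u t)) {t₀ : ℝ} (ht₀ : t₀ ∈ W)
    (h0 : v t₀ ≠ 0) : ∃ r > 0, Set.Ioo (t₀ - r) (t₀ + r) ⊆ W ∧
      ByQuadratures (Set.Ioo (t₀ - r) (t₀ + r)) u := by
  have hRc : Continuous R := continuousOn_univ.mp hR.continuousOn
  -- `σ` is the sign of the velocity at `t₀`; it selects the branch `u̇ = σ√R(u)`.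
  obtain ⟨σ, hσ, hσv⟩ : ∃ σ : ℝ, σ ^ 2 = 1 ∧ 0 < σ * v t₀ := by
    rcases lt_or_gt_of_ne h0 with h | h
    · exact ⟨-1, by norm_num, by linarith⟩
    · exact ⟨1, by norm_num, by linarith⟩
  have hR0 : 0 < R (u t₀) := by rw [← huv t₀ ht₀]; positivity
  obtain ⟨ρ, hρ, hρR⟩ : ∃ ρ > 0, ∀ x ∈ Metric.ball (u t₀) ρ, 0 < R x :=
    Metric.eventually_nhds_iff_ball.mp (hRc.continuousAt.eventually (lt_mem_nhds hR0))
  set V := Metric.ball (u t₀) ρ with hVdef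
  have hV : IsOpen V := Metric.isOpen_ball
  obtain ⟨r, hr, hrW⟩ : ∃ r > 0, ∀ t ∈ Metric.ball t₀ r, t ∈ W ∧ u t ∈ V ∧ 0 < σ * v t := by
    refine Metric.eventually_nhds_iff_ball.mp ?_
    have hvc : ContinuousAt (fun t => σ * v t) t₀ :=
      continuousAt_const.mul (hv.continuousAt (hW.mem_nhds ht₀))
    filter_upwards [hW.mem_nhds ht₀,
      (hu t₀ ht₀).continuousAt.preimage_mem_nhds (hV.mem_nhds (Metric.mem_ball_self hρ)),
      hvc.eventually (lt_mem_nhds hσv)] with t h1 h2 h3 using ⟨h1, h2, h3⟩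
  rw [Real.ball_eq_Ioo] at hrW
  refine ⟨r, hr, fun t ht => (hrW t ht).1, ?_⟩
  -- `y` is `dt/du`; its integral `T` expresses time through `u`, and `u` is the local inverse of
  -- `T`.
  let y : ℝ → ℝ := fun x => σ / √(R x)
  have hs : ByQuadratures V fun x => √(R x) :=
    of_sq (hR.mono isOpen_univ (Set.subset_univ _)) hRc.sqrt.continuousOn
      (fun x hx => Real.sq_sqrt (hρR x hx).le) fun x hx => (Real.sqrt_pos.mpr (hρR x hx)).ne'
  have hs0 : ∀ x ∈ V, √(R x) ≠ 0 := fun x hx => (Real.sqrt_pos.mpr (hρR x hx)).ne'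
  have hy : ByQuadratures V y := (const V σ).div hs hs0
  have hyu : ∀ t ∈ Set.Ioo (t₀ - r) (t₀ + r), y (u t) * v t = 1 := by
    intro t ht
    obtain ⟨h1, h2, h3⟩ := hrW t ht
    have : √(R (u t)) = σ * v t := by
      rw [← huv t h1, Real.sqrt_eq_iff_mul_self_eq (by positivity) h3.le]
      linear_combination -v t ^ 2 * hσ
    have hσ0 : σ ≠ 0 := by rintro rfl; norm_num at hσ
    have hv0 : v t ≠ 0 := by intro h; simp [h] at h3
    simp only [y, this]
    field_simp
  let T : ℝ → ℝ := fun x => t₀ + ∫ s in u t₀..x, y s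
  have hT : ∀ x ∈ V, HasDerivAt T (y x) x := by
    intro x hx
    have hsub : Set.uIcc (u t₀) x ⊆ V :=
      (convex_ball (u t₀) ρ).ordConnected.uIcc_subset (Metric.mem_ball_self hρ) hx
    have hyc : ContinuousAt y x := hy.continuousOn.continuousAt (hV.mem_nhds hx)
    exact (intervalIntegral.integral_hasDerivAt_right
      ((hy.continuousOn.mono hsub).intervalIntegrable)
      (hy.continuousOn.stronglyMeasurableAtFilter hV x hx) hyc).const_add t₀
  have hTq : ByQuadratures V T := quadrature hy hT
  refine inverse hV hTq (fun s hs' => ?_) (fun t ht =>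
    (hu t (hrW t ht).1).continuousAt.continuousWithinAt) (fun t ht => (hrW t ht).2.1) ?_
  · rw [(hT s hs').deriv]
    exact div_ne_zero (by rintro rfl; norm_num at hσ) (hs0 s hs')
  · have hd : ∀ t ∈ Set.Ioo (t₀ - r) (t₀ + r), HasDerivAt (fun t => T (u t) - t) 0 t := by
      intro t ht
      have := ((hT (u t) (hrW t ht).2.1).comp t (hu t (hrW t ht).1)).sub (hasDerivAt_id t)
      rw [hyu t ht, sub_self] at this
      exact this
    intro t ht
    have h00 : t₀ ∈ Set.Ioo (t₀ - r) (t₀ + r) := ⟨by linarith, by linarith⟩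
    have := isOpen_Ioo.is_const_of_deriv_eq_zero isPreconnected_Ioo
      (fun t ht => (hd t ht).differentiableAt.differentiableWithinAt)
      (fun t ht => (hd t ht).deriv) ht h00
    simp only [T, intervalIntegral.integral_same] at this ⊢
    linarith

end ByQuadratures

/-! ### The reduced equations in a frame adapted to the axis -/

lemma exists_Ioo_subset {W : Set ℝ} (hW : IsOpen W) {t : ℝ} (ht : t ∈ W) :
    ∃ r > 0, Set.Ioo (t - r) (t + r) ⊆ W := by
  obtain ⟨r, hr, h⟩ := Metric.isOpen_iff.mp hW t ht
  exact ⟨r, hr, by rwa [← Real.ball_eq_Ioo]⟩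

lemma eq_on_Ioo_of_hasDerivAt_zero {f : ℝ → ℝ} {a b : ℝ}
    (h : ∀ t ∈ Set.Ioo a b, HasDerivAt f 0 t) {s t : ℝ} (hs : s ∈ Set.Ioo a b)
    (ht : t ∈ Set.Ioo a b) : f s = f t :=
  isOpen_Ioo.is_const_of_deriv_eq_zero isPreconnected_Ioo
    (fun t ht => (h t ht).differentiableAt.differentiableWithinAt) (fun t ht => (h t ht).deriv) hs ht

lemma ByQuadratures.of_hasDerivAt_zero {f : ℝ → ℝ} {a b : ℝ}
    (h : ∀ t ∈ Set.Ioo a b, HasDerivAt f 0 t) : ByQuadratures (Set.Ioo a b) f := by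
  rcases (Set.Ioo a b).eq_empty_or_nonempty with h0 | ⟨s, hs⟩
  · rw [h0]
    exact (ByQuadratures.const ∅ 0).congr (by simp)
  · exact (ByQuadratures.const _ (f s)).congr fun t ht => eq_on_Ioo_of_hasDerivAt_zero h hs ht

lemma deriv_eq_zero_of_zero_on {W : Set ℝ} (hW : IsOpen W) {f : ℝ → ℝ} {f' t : ℝ} (ht : t ∈ W)
    (hf : ∀ s ∈ W, f s = 0) (h : HasDerivAt f f' t) : f' = 0 :=
  h.unique ((hasDerivAt_const t (0 : ℝ)).congr_of_eventuallyEq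
    (by filter_upwards [hW.mem_nhds ht] with s hs using hf s hs))

/-- The equations satisfied along a solution by the components of `M` and `Γ` in an orthogonal
frame containing `(X₀, 0, Z₀)`: `u, g, w` are the components of `Γ` and `p, q` those of `M`
orthogonal to the axis, `N` is the squared length of the axis. -/
structure ReducedSolution (W : Set ℝ) (I N c₁ c₂ h₁ h₂ α β : ℝ) (u p q g w : ℝ → ℝ) : Prop where
  hu : ∀ t ∈ W, HasDerivAt u ((q t * g t - p t * w t) / I) t
  hp : ∀ t ∈ W, HasDerivAt p (N * (w t + (α + β * u t) * q t)) t
  hq : ∀ t ∈ W, HasDerivAt q (-g t - (α + β * u t) * p t) t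
  hg : ContinuousOn g W
  hw : ContinuousOn w W
  area : ∀ t ∈ W, p t * g t + N * q t * w t = N * c₁ - h₂ * u t
  energy : ∀ t ∈ W, p t ^ 2 + N * q t ^ 2 = 2 * I * N * (h₁ - u t) - h₂ ^ 2
  sphere : ∀ t ∈ W, g t ^ 2 + N * w t ^ 2 = N * c₂ - u t ^ 2

namespace ReducedSolution

variable {W : Set ℝ} {I N c₁ c₂ h₁ h₂ α β : ℝ} {u p q g w : ℝ → ℝ}

lemma mono (h : ReducedSolution W I N c₁ c₂ h₁ h₂ α β u p q g w) {V : Set ℝ} (hV : V ⊆ W) :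
    ReducedSolution V I N c₁ c₂ h₁ h₂ α β u p q g w where
  hu t ht := h.hu t (hV ht)
  hp t ht := h.hp t (hV ht)
  hq t ht := h.hq t (hV ht)
  hg := h.hg.mono hV
  hw := h.hw.mono hV
  area t ht := h.area t (hV ht)
  energy t ht := h.energy t (hV ht)
  sphere t ht := h.sphere t (hV ht)

lemma continuousOn_p (h : ReducedSolution W I N c₁ c₂ h₁ h₂ α β u p q g w) : ContinuousOn p W :=
  fun t ht => (h.hp t ht).continuousAt.continuousWithinAt

lemma continuousOn_q (h : ReducedSolution W I N c₁ c₂ h₁ h₂ α β u p q g w) : ContinuousOn q W :=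
  fun t ht => (h.hq t ht).continuousAt.continuousWithinAt

/-- All components are known on `U`. -/
def Known (U : Set ℝ) (u p q g w : ℝ → ℝ) : Prop :=
  ByQuadratures U u ∧ ByQuadratures U p ∧ ByQuadratures U q ∧ ByQuadratures U g ∧ ByQuadratures U w

/-- If `M` stays parallel to the axis, differentiating `p = q = 0` forces `g = w = 0`, and then `u̇
= 0`. -/
lemma known_of_vertical (h : ReducedSolution W I N c₁ c₂ h₁ h₂ α β u p q g w) (hN : 0 < N)
    (hW : IsOpen W) (h0 : ∀ t ∈ W, p t ^ 2 + N * q t ^ 2 = 0) {a b : ℝ}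
    (hab : Set.Ioo a b ⊆ W) : Known (Set.Ioo a b) u p q g w := by
  have hq : ∀ t ∈ W, q t = 0 := fun t ht => by
    have := h0 t ht
    have : N * q t ^ 2 = 0 := by nlinarith [sq_nonneg (p t), mul_nonneg hN.le (sq_nonneg (q t))]
    simpa [hN.ne'] using this
  have hp : ∀ t ∈ W, p t = 0 := fun t ht => by
    have := h0 t ht
    rw [hq t ht] at this
    simpa using this
  have hg : ∀ t ∈ W, g t = 0 := fun t ht => by
    have := deriv_eq_zero_of_zero_on hW ht hq (h.hq t ht)
    rw [hp t ht] at this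
    linarith
  have hw : ∀ t ∈ W, w t = 0 := fun t ht => by
    have := deriv_eq_zero_of_zero_on hW ht hp (h.hp t ht)
    rw [hq t ht] at this
    simpa [hN.ne'] using this
  have hz : ∀ {f : ℝ → ℝ}, (∀ t ∈ W, f t = 0) → ByQuadratures (Set.Ioo a b) f := fun hf =>
    (ByQuadratures.const _ 0).congr fun t ht => (hf t (hab ht)).symm
  refine ⟨ByQuadratures.of_hasDerivAt_zero fun t ht => ?_, hz hp, hz hq, hz hg, hz hw⟩
  have := h.hu t (hab ht)
  rwa [hp t (hab ht), hq t (hab ht), zero_mul, zero_mul, sub_zero, zero_div] at this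

/-- Once `u` and `u̇` are known, the remaining components follow by one more quadrature. -/
lemma known_of_height {U : Set ℝ} (h : ReducedSolution U I N c₁ c₂ h₁ h₂ α β u p q g w)
    (hN : 0 < N) (hU : IsOpen U) (hu : ByQuadratures U u)
    (hv : ByQuadratures U fun t => q t * g t - p t * w t)
    (h0 : ∀ t ∈ U, p t ^ 2 + N * q t ^ 2 ≠ 0) {t₀ : ℝ} (ht₀ : t₀ ∈ U) :
    ∃ r > 0, Set.Ioo (t₀ - r) (t₀ + r) ⊆ U ∧ Known (Set.Ioo (t₀ - r) (t₀ + r)) u p q g w := by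
  have hs : √N ^ 2 = N := Real.sq_sqrt hN.le
  have hs0 : √N ≠ 0 := (Real.sqrt_pos.mpr hN).ne'
  have hD : ByQuadratures U fun t => p t ^ 2 + N * q t ^ 2 :=
    (((ByQuadratures.const U (2 * I * N * h₁ - h₂ ^ 2)).sub (hu.const_mul (2 * I * N)))).congr
      fun t ht => by rw [h.energy t ht]; ring
  have hA : ByQuadratures U fun t => p t * g t + N * q t * w t :=
    ((ByQuadratures.const U (N * c₁)).sub (hu.const_mul h₂)).congr
      fun t ht => (h.area t ht).symm
  -- This is the angular momentum of the plane curve `(p, √N q)`, computed from the equations for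
  -- `ṗ` and `q̇`; it depends on `u` alone.
  have hB : ByQuadratures U fun t => √N * (-(p t * g t + N * q t * w t)
      - (α + β * u t) * (p t ^ 2 + N * q t ^ 2)) :=
    (((hA.const_mul (-1)).sub (((ByQuadratures.const U α).add (hu.const_mul β)).mul hD)).const_mul
      √N).congr fun t _ => by ring
  have hsq : ∀ t ∈ U, HasDerivAt (fun t => √N * q t) (√N * (-g t - (α + β * u t) * p t)) t :=
    fun t ht => (h.hq t ht).const_mul _
  have hpq : ∃ V ⊆ U, IsOpen V ∧ t₀ ∈ V ∧ ByQuadratures V p ∧ ByQuadratures V q := by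
    -- `polar` needs a nonvanishing first coordinate; when `p` vanishes at `t₀` the two are
    -- exchanged, which reverses the sign of the angular momentum.
    by_cases hp0 : p t₀ = 0
    · have hq0 : q t₀ ≠ 0 := by
        intro hq0
        exact h0 t₀ ht₀ (by rw [hp0, hq0]; ring)
      have hV := h.continuousOn_q.isOpen_inter_preimage hU (isOpen_compl_singleton (x := (0 : ℝ)))
      refine ⟨_, Set.inter_subset_left, hV, ⟨ht₀, hq0⟩, ?_⟩
      have := ByQuadratures.polar (fun t ht => hsq t ht.1) (fun t ht => h.hp t ht.1)
        (hD.mono hU Set.inter_subset_left) ((hB.const_mul (-1)).mono hU Set.inter_subset_left)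
        (fun t ht => by linear_combination q t ^ 2 * hs) (fun t ht => by ring)
        (fun t ht => mul_ne_zero hs0 ht.2)
      exact ⟨this.2, (this.1.const_mul (√N)⁻¹).congr fun t _ => by field_simp⟩
    · have hV := h.continuousOn_p.isOpen_inter_preimage hU (isOpen_compl_singleton (x := (0 : ℝ)))
      refine ⟨_, Set.inter_subset_left, hV, ⟨ht₀, hp0⟩, ?_⟩
      have := ByQuadratures.polar (fun t ht => h.hp t ht.1) (fun t ht => hsq t ht.1)
        (hD.mono hU Set.inter_subset_left) (hB.mono hU Set.inter_subset_left)
        (fun t ht => by linear_combination q t ^ 2 * hs) (fun t ht => by ring)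
        (fun t ht => ht.2)
      exact ⟨this.1, (this.2.const_mul (√N)⁻¹).congr fun t _ => by field_simp⟩
  obtain ⟨V, hVU, hV, ht, hp, hq⟩ := hpq
  obtain ⟨r, hr, hrV⟩ := exists_Ioo_subset hV ht
  refine ⟨r, hr, hrV.trans hVU, ?_⟩
  replace hp := hp.mono hV hrV
  replace hq := hq.mono hV hrV
  replace hu := hu.mono hU (hrV.trans hVU)
  replace hv := hv.mono hU (hrV.trans hVU)
  replace hA := hA.mono hU (hrV.trans hVU)
  replace hD := hD.mono hU (hrV.trans hVU)
  have h0' : ∀ t ∈ Set.Ioo (t₀ - r) (t₀ + r), p t ^ 2 + N * q t ^ 2 ≠ 0 :=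
    fun t ht => h0 t (hVU (hrV ht))
  -- `g` and `w` solve the linear system with known values of `pg + Nqw` and `qg - pw`, whose
  -- determinant is `-(p² + Nq²)`.
  refine ⟨hu, hp, hq, ?_, ?_⟩
  · refine (((hp.mul hA).add ((hq.mul hv).const_mul N)).div hD h0').congr fun t ht => ?_
    rw [div_eq_iff (h0' t ht)]
    ring
  · refine (((hq.mul hA).sub (hp.mul hv)).div hD h0').congr fun t ht => ?_
    rw [div_eq_iff (h0' t ht)]
    ring

/-- Some subinterval of times on which the whole reduced solution is known. -/
lemma exists_known (h : ReducedSolution W I N c₁ c₂ h₁ h₂ α β u p q g w) (hI : I ≠ 0)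
    (hN : 0 < N) (hW : IsOpen W) (hne : W.Nonempty) :
    ∃ t, ∃ r > 0, Set.Ioo (t - r) (t + r) ⊆ W ∧ Known (Set.Ioo (t - r) (t + r)) u p q g w := by
  by_cases hD : ∀ t ∈ W, p t ^ 2 + N * q t ^ 2 = 0
  · obtain ⟨t, ht⟩ := hne
    obtain ⟨r, hr, hrW⟩ := exists_Ioo_subset hW ht
    exact ⟨t, r, hr, hrW, h.known_of_vertical hN hW hD hrW⟩
  push Not at hD
  obtain ⟨t₁, ht₁, hD₁⟩ := hD
  have hDc : ContinuousOn (fun t => p t ^ 2 + N * q t ^ 2) W :=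
    (h.continuousOn_p.pow 2).add (continuousOn_const.mul (h.continuousOn_q.pow 2))
  have hV := hDc.isOpen_inter_preimage hW (isOpen_compl_singleton (x := (0 : ℝ)))
  set V := W ∩ (fun t => p t ^ 2 + N * q t ^ 2) ⁻¹' {0}ᶜ with hVdef
  have hVW : V ⊆ W := Set.inter_subset_left
  have hV0 : ∀ t ∈ V, p t ^ 2 + N * q t ^ 2 ≠ 0 := fun t ht => ht.2
  have ht₁V : t₁ ∈ V := ⟨ht₁, hD₁⟩
  have hh := h.mono hVW
  -- Either `u` is constant on `V`, or it moves at some time and the equation `u̇² = R(u)` can be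
  -- inverted there.
  by_cases hv : ∀ t ∈ V, q t * g t - p t * w t = 0
  · obtain ⟨r, hr, hrV⟩ := exists_Ioo_subset hV ht₁V
    obtain ⟨r', hr', hrV', hk⟩ := (hh.mono hrV).known_of_height hN isOpen_Ioo
      (ByQuadratures.of_hasDerivAt_zero fun t ht => by
        simpa [hv t (hrV ht)] using hh.hu t (hrV ht))
      ((ByQuadratures.const _ 0).congr fun t ht => (hv t (hrV ht)).symm)
      (fun t ht => hV0 t (hrV ht)) (t₀ := t₁) ⟨by linarith, by linarith⟩
    exact ⟨t₁, r', hr', (hrV'.trans hrV).trans hVW, hk⟩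
  push Not at hv
  obtain ⟨t₂, ht₂, hv₂⟩ := hv
  have hvc : ContinuousOn (fun t => q t * g t - p t * w t) V :=
    (hh.continuousOn_q.mul hh.hg).sub (hh.continuousOn_p.mul hh.hw)
  have hV' := hvc.isOpen_inter_preimage hV (isOpen_compl_singleton (x := (0 : ℝ)))
  set V' := V ∩ (fun t => q t * g t - p t * w t) ⁻¹' {0}ᶜ with hVdef'
  have hVV' : V' ⊆ V := Set.inter_subset_left
  have hh' := hh.mono hVV'
  -- From `(p² + Nq²)(g² + Nw²) = (pg + Nqw)² + N(qg - pw)²` and `I u̇ = qg - pw`: the three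
  -- integrals turn `u̇²` into this cubic in `u`.
  let R : ℝ → ℝ := fun x => (N * I ^ 2)⁻¹ * (((2 * I * N * h₁ - h₂ ^ 2) - (2 * I * N) * x)
    * (N * c₂ - x * x) - (N * c₁ - h₂ * x) * (N * c₁ - h₂ * x))
  have hR : ByQuadratures Set.univ R := by
    have hid := ByQuadratures.ident Set.univ
    have hA := (ByQuadratures.const Set.univ (N * c₁)).sub (hid.const_mul h₂)
    exact ((((ByQuadratures.const _ (2 * I * N * h₁ - h₂ ^ 2)).sub
      (hid.const_mul (2 * I * N))).mul ((ByQuadratures.const _ (N * c₂)).sub (hid.mul hid))).sub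
      (hA.mul hA)).const_mul _
  obtain ⟨r, hr, hrV, hu⟩ := ByQuadratures.of_autonomous hV' (R := R) hh'.hu
    ((hvc.mono hVV').div_const I) hR (fun t ht => by
      have h1 := hh'.area t ht
      have h2 := hh'.energy t ht
      have h3 := hh'.sphere t ht
      have : R (u t) = (N * I ^ 2)⁻¹ * ((p t ^ 2 + N * q t ^ 2) * (g t ^ 2 + N * w t ^ 2)
          - (p t * g t + N * q t * w t) ^ 2) := by
        rw [h1, h2, h3]
        simp only [R]
        ring
      rw [this]
      field_simp
      ring) (t₀ := t₂) ⟨ht₂, hv₂⟩ (div_ne_zero hv₂ hI)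
  have hv : ByQuadratures (Set.Ioo (t₂ - r) (t₂ + r)) fun t => q t * g t - p t * w t := by
    have hid := hu
    have hA := (ByQuadratures.const _ (N * c₁)).sub (hid.const_mul h₂)
    refine ByQuadratures.of_sq (((((ByQuadratures.const _ (2 * I * N * h₁ - h₂ ^ 2)).sub
      (hid.const_mul (2 * I * N))).mul ((ByQuadratures.const _ (N * c₂)).sub (hid.mul hid))).sub
      (hA.mul hA)).const_mul N⁻¹) (hvc.mono (hrV.trans hVV')) (fun t ht => ?_)
      (fun t ht => (hrV ht).2)
    have h1 := hh'.area t (hrV ht)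
    have h2 := hh'.energy t (hrV ht)
    have h3 := hh'.sphere t (hrV ht)
    field_simp
    linear_combination (-(p t * g t + N * q t * w t) - (N * c₁ - h₂ * u t)) * h1
      + (g t ^ 2 + N * w t ^ 2) * h2 + (2 * I * N * (h₁ - u t) - h₂ ^ 2) * h3
  obtain ⟨r', hr', hrV', hk⟩ := (hh'.mono hrV).known_of_height hN isOpen_Ioo hu hv
    (fun t ht => hV0 t (hVV' (hrV ht))) (t₀ := t₂) ⟨by linarith, by linarith⟩
  exact ⟨t₂, r', hr', ((hrV'.trans hrV).trans hVV').trans hVW, hk⟩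

end ReducedSolution

/-! ### Reconstruction of the solution, cases (iv) and (v) -/

lemma const_along {f : Phase → ℝ} {V : Phase → Phase} (hf : IsFirstIntegral V f) {γ : ℝ → Phase}
    {a b : ℝ} (hγ : ∀ t ∈ Set.Ioo a b, HasDerivAt γ (V (γ t)) t) {s t : ℝ}
    (hs : s ∈ Set.Ioo a b) (ht : t ∈ Set.Ioo a b) : f (γ s) = f (γ t) :=
  eq_on_Ioo_of_hasDerivAt_zero (f := fun t => f (γ t)) (fun t ht => by
    have := (differentiableAt_of_smooth hf.1 (γ t)).hasFDerivAt.comp_hasDerivAt t (hγ t ht)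
    rwa [hf.2] at this) hs ht

/-- Solvability by quadratures when `a` is, on each level set of `H₁`, an affine function of
`X₀Γ₁ + Z₀Γ₃`. -/
lemma solvableByQuadratures_system {I X Z : ℝ} (hI : I ≠ 0) (hXZ : X ≠ 0 ∨ Z ≠ 0)
    {a : Phase → ℝ} (ha : ∀ h, ∃ α β : ℝ, ∀ x, H₁ I X Z x = h →
      a x = α + β * (X * gam x 0 + Z * gam x 2)) : SolvableByQuadratures (system I X Z a) := by
  intro J γ hJ hγ t₀ ht₀
  have hN := normSq_pos hXZ
  rw [Metric.mem_closure_iff]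
  intro ε hε
  obtain ⟨r₀, hr₀, hrJ⟩ := exists_Ioo_subset hJ ht₀
  -- Shrinking the interval below `ε` means that one good time anywhere inside it suffices for
  -- density.
  set r := min r₀ ε with hr
  have hrpos : 0 < r := lt_min hr₀ hε
  have hsub : Set.Ioo (t₀ - r) (t₀ + r) ⊆ J := (Set.Ioo_subset_Ioo
    (by linarith [min_le_left r₀ ε]) (by linarith [min_le_left r₀ ε])).trans hrJ
  set W := Set.Ioo (t₀ - r) (t₀ + r) with hW
  have hγW : ∀ t ∈ W, HasDerivAt γ (system I X Z a (γ t)) t := fun t ht => hγ t (hsub ht)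
  have htW : t₀ ∈ W := ⟨by linarith, by linarith⟩
  have hint := isFirstIntegral_system I X Z a
  have hF₁ : ∀ t ∈ W, F₁ (γ t) = F₁ (γ t₀) := fun t ht => const_along (hint 0) hγW ht htW
  have hF₂ : ∀ t ∈ W, F₂ (γ t) = F₂ (γ t₀) := fun t ht => const_along (hint 1) hγW ht htW
  have hH₁ : ∀ t ∈ W, H₁ I X Z (γ t) = H₁ I X Z (γ t₀) := fun t ht =>
    const_along (hint 2) hγW ht htW
  have hH₂ : ∀ t ∈ W, H₂ X Z (γ t) = H₂ X Z (γ t₀) := fun t ht =>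
    const_along (hint 3) hγW ht htW
  obtain ⟨α, β, hαβ⟩ := ha (H₁ I X Z (γ t₀))
  have hcoord : ∀ t ∈ W, ∀ p, HasDerivAt (fun s => γ s p) (system I X Z a (γ t) p) t :=
    fun t ht p => hasDerivAt_pi.mp (hγW t ht) p
  have haW : ∀ t ∈ W, a (γ t) = α + β * (X * gam (γ t) 0 + Z * gam (γ t) 2) :=
    fun t ht => hαβ _ (hH₁ t ht)
  have hred : ReducedSolution W I (X ^ 2 + Z ^ 2) (F₁ (γ t₀)) (F₂ (γ t₀)) (H₁ I X Z (γ t₀))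
      (H₂ X Z (γ t₀)) α β (fun t => X * γ t (.inr 0) + Z * γ t (.inr 2))
      (fun t => Z * γ t (.inl 0) - X * γ t (.inl 2)) (fun t => γ t (.inl 1))
      (fun t => Z * γ t (.inr 0) - X * γ t (.inr 2)) (fun t => γ t (.inr 1)) := by
    constructor
    · intro t ht
      refine (((hcoord t ht (.inr 0)).const_mul X).add
        ((hcoord t ht (.inr 2)).const_mul Z)).congr_deriv ?_
      simp [system, mom, gam]
      ring
    · intro t ht
      refine (((hcoord t ht (.inl 0)).const_mul Z).sub
        ((hcoord t ht (.inl 2)).const_mul X)).congr_deriv ?_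
      simp [system, haW t ht, mom, gam]
      ring
    · intro t ht
      refine (hcoord t ht (.inl 1)).congr_deriv ?_
      simp [system, haW t ht, mom, gam]
      ring
    · exact fun t ht => (((hcoord t ht (.inr 0)).const_mul Z).sub
        ((hcoord t ht (.inr 2)).const_mul X)).continuousAt.continuousWithinAt
    · exact fun t ht => (hcoord t ht (.inr 1)).continuousAt.continuousWithinAt
    · intro t ht
      rw [← hF₁ t ht, ← hH₂ t ht]
      simp only [F₁, H₂, mom, gam]
      ring
    · intro t ht
      rw [← hH₁ t ht, ← hH₂ t ht]
      simp only [H₁, H₂, mom, gam]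
      field_simp
      ring
    · intro t ht
      rw [← hF₂ t ht]
      simp only [F₂, gam]
      ring
  obtain ⟨t, r', hr', hrW, hu, hp, hq, hg, hw⟩ := hred.exists_known hI hN isOpen_Ioo ⟨t₀, htW⟩
  have htW' : t ∈ W := hrW ⟨by linarith, by linarith⟩
  refine ⟨t, ⟨r', hr', hrW.trans hsub, ?_⟩, ?_⟩
  · have hH : ∀ s ∈ Set.Ioo (t - r') (t + r'),
        X * γ s (.inl 0) + Z * γ s (.inl 2) = H₂ X Z (γ t₀) := fun s hs => hH₂ s (hrW hs)
    have hc := ByQuadratures.const (Set.Ioo (t - r') (t + r')) (H₂ X Z (γ t₀))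
    have hN' := hN.ne'
    -- `M₁, M₃` are recovered from `H₂` and `p`, and `Γ₁, Γ₃` from `u` and `g`, by inverting a
    -- linear map of determinant `-(X² + Z²)`.
    rintro (i | i) <;> fin_cases i
    · refine (((hc.const_mul X).add (hp.const_mul Z)).const_mul (X ^ 2 + Z ^ 2)⁻¹).congr
        fun s hs => ?_
      rw [← hH s hs, inv_mul_eq_iff_eq_mul₀ hN']
      simp
      ring
    · exact hq
    · refine (((hc.const_mul Z).sub (hp.const_mul X)).const_mul (X ^ 2 + Z ^ 2)⁻¹).congr
        fun s hs => ?_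
      rw [← hH s hs, inv_mul_eq_iff_eq_mul₀ hN']
      simp
      ring
    · refine (((hu.const_mul X).add (hg.const_mul Z)).const_mul (X ^ 2 + Z ^ 2)⁻¹).congr
        fun s hs => ?_
      rw [inv_mul_eq_iff_eq_mul₀ hN']
      simp
      ring
    · exact hw
    · refine (((hu.const_mul Z).sub (hg.const_mul X)).const_mul (X ^ 2 + Z ^ 2)⁻¹).congr
        fun s hs => ?_
      rw [inv_mul_eq_iff_eq_mul₀ hN']
      simp
      ring
  · rw [Real.dist_eq, abs_lt]
    have := min_le_right r₀ ε
    constructor <;> linarith [htW'.1, htW'.2]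

lemma isIntegrableInQuadratures_aIV {I X Z : ℝ} (hI : I ≠ 0) (hXZ : X ≠ 0 ∨ Z ≠ 0) :
    IsIntegrableInQuadraturesWith (system I X Z (aIV X Z)) ![F₁, F₂, H₁ I X Z, H₂ X Z] :=
  ⟨preservesStandardMeasure_aIV I X Z, isFirstIntegral_system I X Z _, dense_independentAt hI hXZ,
    solvableByQuadratures_system hI hXZ fun _ => ⟨0, 1, fun x _ => by simp [aIV]⟩⟩

/-- On the level `H₁ = h` one has `|M|² = 2I(h - u)`, which is where the affine coefficients come
from. -/
lemma isIntegrableInQuadratures_aV {I X Z : ℝ} (hI : I ≠ 0) (hXZ : X ≠ 0 ∨ Z ≠ 0) :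
    IsIntegrableInQuadraturesWith (system I X Z aV) ![F₁, F₂, H₁ I X Z, H₂ X Z] :=
  ⟨preservesStandardMeasure_aV I X Z, isFirstIntegral_system I X Z _, dense_independentAt hI hXZ,
    solvableByQuadratures_system hI hXZ fun h => ⟨2 * I * h, -(2 * I), fun x hx => by
      rw [← hx, H₁, aV]
      field_simp
      ring⟩⟩

end RigidE3

theorem mainTheorem9 (I₂ X₀ Z₀ : ℝ) (hI : I₂ ≠ 0) (hXZ : X₀ ≠ 0 ∨ Z₀ ≠ 0) :
    (RigidE3.IsLiouvilleIntegrable (RigidE3.system I₂ X₀ Z₀ RigidE3.aI) ∧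
      RigidE3.IsLiouvilleIntegrable (RigidE3.system I₂ X₀ Z₀ RigidE3.aII) ∧
      RigidE3.IsLiouvilleIntegrable (RigidE3.system I₂ X₀ Z₀ (RigidE3.aIII X₀ Z₀))) ∧
    (RigidE3.IsIntegrableInQuadraturesWith (RigidE3.system I₂ X₀ Z₀ (RigidE3.aIV X₀ Z₀))
        ![RigidE3.F₁, RigidE3.F₂, RigidE3.H₁ I₂ X₀ Z₀, RigidE3.H₂ X₀ Z₀] ∧
      RigidE3.IsIntegrableInQuadraturesWith (RigidE3.system I₂ X₀ Z₀ RigidE3.aV)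
        ![RigidE3.F₁, RigidE3.F₂, RigidE3.H₁ I₂ X₀ Z₀, RigidE3.H₂ X₀ Z₀]) := by
  exact ⟨⟨RigidE3.isLiouvilleIntegrable_aI hI hXZ, RigidE3.isLiouvilleIntegrable_aII hI hXZ,
    RigidE3.isLiouvilleIntegrable_aIII hI hXZ⟩, RigidE3.isIntegrableInQuadratures_aIV hI hXZ,
    RigidE3.isIntegrableInQuadratures_aV hI hXZ⟩
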